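/- All categories are preadditive and all functors between them are additive. A ring with several objects is a small preadditive category $\mathcal G$. A $\mathcal G$-module is a functor $\mathcal G^{\mathrm{op}}\to\mathrm{Ab}$, and $\mathrm{Mod}(\mathcal G)$ is the abelian category of $\mathcal G$-modules and natural transformations. A full subcategory $\mathcal L$ of $\mathrm{Mod}(\mathcal G)$ is localizing if it is closed under subobjects, quotients, extensions and direct sums. For such $\mathcal L$, let $Q:\mathrm{Mod}(\mathcal G)\to\mathrm{Mod}(\mathcal G)/\mathcal L$ be the quotient functor (the localization at the morphisms with kernel and cokernel in $\mathcal L$) and let $R$ be its right adjoint. A module $X$ is $\mathcal L$-closed if $\mathrm{Hom}_{\mathcal G}(L,X)=0=\mathrm{Ext}^1_{\mathcal G}(L,X)$ for all $L\in\mathcal L$. For a functor $F:\mathcal G\to\mathcal A$ into a cocomplete abelian category, let $F^*:\mathrm{Mod}(\mathcal G)\to\mathcal A$ be the left adjoint of $A\mapsto\mathcal A(F-,A)$, that is, the colimit preserving functor, unique up to natural isomorphism, with $F^*\,\mathcal G(-,G)\cong FG$ naturally in $G\in\mathcal G$. Call $F$ generalized $\mathcal L$-closed if $F^*$ annihilates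 every module in $\mathcal L$ and preserves exactness of every exact sequence $0\to M\to N\to L\to 0$ with $L\in\mathcal L$. A functor $S:\mathcal U\to\mathcal G$ between rings with several objects is called an $\mathcal L$-conditioned epimorphism if, for all functors $F,F':\mathcal G\to\mathcal A$ into a cocomplete abelian category with $F$ generalized $\mathcal L$-closed, $F\circ S=F'\circ S$ implies $F=F'$. Let $S_*:\mathrm{Mod}(\mathcal G)\to\mathrm{Mod}(\mathcal U)$, $X\mapsto X\circ S$. **Theorem.** Let $S:\mathcal U\to\mathcal G$ be a functor between rings with several objects that is bijective on objects, and let $\mathcal L$ be a localizing subcategory of $\mathrm{Mod}(\mathcal G)$ such that the module $\mathcal G(-,G)$ is $\mathcal L$-closed for every $G\in\mathcal G$. Then the following are equivalent: (i) $S_*\circ R$ is full; (ii) $S_*\circ R$ is fully faithful; (iii) $S$ is an $\mathcal L$-conditioned epimorphism. -/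

import Mathlib

open CategoryTheory CategoryTheory.Limits Opposite
universe w a v u v' u'

noncomputable section

namespace SeveralObjects

section Additive

variable {C : Type u} [Category.{v} C] [Preadditive C]
  {D : Type u'} [Category.{v'} D] [Preadditive D]

instance isClosedUnderLimitsOfShape_additiveFunctor (J : Type*) [Category* J]
    [HasLimitsOfShape J D] : (additiveFunctor C D).IsClosedUnderLimitsOfShape J where
  limitsOfShape_le := by
    rintro F ⟨p⟩
    rw [additiveFunctor_iff]
    refine ⟨fun {X Y f g} => ?_⟩
    refine ((isLimitOfPreserves ((evaluation C D).obj Y) p.isLimit)).hom_ext fun j => ?_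
    have := (additiveFunctor_iff _).1 (p.prop_diag_obj j)
    have h (f : X ⟶ Y) := (p.π.app j).naturality f
    dsimp at h
    simp [Preadditive.add_comp, h, Functor.map_add]

instance isClosedUnderColimitsOfShape_additiveFunctor (J : Type*) [Category* J]
    [HasColimitsOfShape J D] : (additiveFunctor C D).IsClosedUnderColimitsOfShape J where
  colimitsOfShape_le := by
    rintro F ⟨p⟩
    rw [additiveFunctor_iff]
    refine ⟨fun {X Y f g} => ?_⟩
    refine ((isColimitOfPreserves ((evaluation C D).obj X) p.isColimit)).hom_ext fun j => ?_
    have := (additiveFunctor_iff _).1 (p.prop_diag_obj j)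
    have h (f : X ⟶ Y) : _ = (p.ι.app j).app X ≫ F.map f := (p.ι.app j).naturality f
    change (p.ι.app j).app X ≫ F.map (f + g) = (p.ι.app j).app X ≫ (F.map f + F.map g)
    rw [Preadditive.comp_add, ← h, ← h, ← h, Functor.map_add, Preadditive.add_comp]

instance [HasFiniteLimits D] : (additiveFunctor C D).IsClosedUnderKernels where
  kernels_le := by
    rintro _ ⟨f, k, hk, hf⟩
    exact ObjectProperty.prop_of_isLimit _ hk (by rintro (_ | _); exacts [hf.1, hf.2])

instance [HasFiniteColimits D] : (additiveFunctor C D).IsClosedUnderCokernels where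
  cokernels_le := by
    rintro _ ⟨f, k, hk, hf⟩
    exact ObjectProperty.prop_of_isColimit _ hk (by rintro (_ | _); exacts [hf.1, hf.2])

instance [HasFiniteProducts D] : (additiveFunctor C D).IsClosedUnderFiniteProducts where
  isClosedUnderLimitsOfShape _ _ := inferInstance

end Additive

/-- The category `ModCat G` of (right) modules over a ring with several objects `G`, i.e. over a
small preadditive category: additive functors `Gᵒᵖ ⥤ Ab` and natural transformations. -/
abbrev ModCat (G : Type w) [SmallCategory G] [Preadditive G] : Type (w + 1) :=
  Gᵒᵖ ⥤+ AddCommGrpCat.{w}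

section ModCat

variable (G : Type w) [SmallCategory G] [Preadditive G]

instance : HasColimitsOfSize.{w, w} (ModCat G) := ⟨fun _ _ => inferInstance⟩

instance : HasLimitsOfSize.{w, w} (ModCat G) := ⟨fun _ _ => inferInstance⟩

instance : PreservesColimitsOfSize.{w, w} (AdditiveFunctor.forget Gᵒᵖ AddCommGrpCat.{w}) where
  preservesColimitsOfShape := inferInstance

instance : PreservesLimitsOfSize.{w, w} (AdditiveFunctor.forget Gᵒᵖ AddCommGrpCat.{w}) where
  preservesLimitsOfShape := inferInstance

instance : AB5OfSize.{w, w} (ModCat G) where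
  ofShape J _ _ :=
    have : PreservesFiniteLimits (AdditiveFunctor.forget Gᵒᵖ AddCommGrpCat.{w}) :=
      PreservesLimitsOfSize.preservesFiniteLimits _
    HasExactColimitsOfShape.domain_of_functor J (AdditiveFunctor.forget Gᵒᵖ AddCommGrpCat.{w})

instance : AB4OfSize.{w} (ModCat G) :=
  have : HasFiniteBiproducts (ModCat G) := HasFiniteBiproducts.of_hasFiniteProducts
  AB4.of_AB5 _

variable {G}

/-- The representable `G`-module `G(-, g)`. -/
abbrev representable (g : G) : ModCat G :=
  AdditiveFunctor.of (preadditiveYoneda.obj g)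

/-- The homomorphism `G(-, g) ⟶ X` that corresponds to `x ∈ X g` under the Yoneda lemma. -/
def representableHom {g : G} (X : ModCat G) (x : X.obj.obj (op g)) : representable g ⟶ X :=
  ObjectProperty.homMk
    { app g' := AddCommGrpCat.ofHom (AddMonoidHom.mk' (fun m : g'.unop ⟶ g => X.obj.map m.op x)
        (fun m m' => by
          have h (a b : g'.unop ⟶ g) :
              X.obj.map (a + b).op = X.obj.map a.op + X.obj.map b.op := by
            rw [op_add, Functor.map_add]
          exact ConcreteCategory.congr_hom (h m m') x))
      naturality g' g'' f := by
        ext m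
        exact ConcreteCategory.congr_hom (X.obj.map_comp (show g'.unop ⟶ g from m).op f) x }

lemma isSeparating_representable : (ObjectProperty.ofObj (representable (G := G))).IsSeparating := by
  intro X Y f f' h
  ext : 1
  ext g x
  have h1 := h _ (ObjectProperty.ofObj_apply _ g.unop) (representableHom X x)
  have h2 := ConcreteCategory.congr_hom (NatTrans.congr_app (congrArg (·.hom) h1) g) (𝟙 g.unop)
  have h3 : X.obj.map (𝟙 g.unop).op x = x := ConcreteCategory.congr_hom (X.obj.map_id g) x
  exact (congrArg (f.hom.app g) h3).symm.trans (h2.trans (congrArg (f'.hom.app g) h3))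

instance : IsGrothendieckAbelian.{w} (ModCat G) where
  hasSeparator := ⟨_, isSeparating_representable.isSeparator_coproduct⟩

end ModCat

section Restriction

/-- The restriction functor `S_* : ModCat G ⥤ ModCat U`, `X ↦ X ∘ S`. -/
def restriction {U G : Type w} [SmallCategory U] [Preadditive U] [SmallCategory G] [Preadditive G]
    (S : U ⥤ G) [S.Additive] : ModCat G ⥤ ModCat U where
  obj X := AdditiveFunctor.of (S.op ⋙ X.obj)
  map f := ObjectProperty.homMk (Functor.whiskerLeft S.op f.hom)

variable {G : Type w} [SmallCategory G] [Preadditive G]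
  {A : Type a} [Category.{w} A] [Preadditive A] (F : G ⥤ A) [F.Additive]

/-- The restriction functor `F_* : A ⥤ ModCat G`, `X ↦ A(F -, X)`. -/
def homRestriction : A ⥤ ModCat G where
  obj X := AdditiveFunctor.of (F.op ⋙ preadditiveYoneda.obj X)
  map f := ObjectProperty.homMk (Functor.whiskerLeft F.op (preadditiveYoneda.map f))

instance : (homRestriction F).Additive where
  map_add {X Y f g} := by
    ext : 1
    ext x y
    exact Preadditive.comp_add _ _ _ _ _ _

end Restriction

section Induction

variable {G : Type w} [SmallCategory G] [Preadditive G]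
  {A : Type a} [Category.{w} A] [Abelian A] [HasColimitsOfSize.{w, w} A]
  (F : G ⥤ A)

namespace Induction

variable (M : ModCat G)

/-- The direct sum of copies of the objects `F g`, indexed by all pairs `(g, m)`, `m ∈ M g`. -/
abbrev gens : A := ∐ fun i : (Σ g : G, M.obj.obj (op g)) => F.obj i.1

abbrev gen (g : G) (m : M.obj.obj (op g)) : F.obj g ⟶ gens F M :=
  Sigma.ι (fun i : (Σ g : G, M.obj.obj (op g)) => F.obj i.1) ⟨g, m⟩

/-- The relations `(m · f) ⊗ - = m ⊗ F f -`, for `f : g ⟶ g'` and `m ∈ M g'`. -/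
abbrev relMap :
    (∐ fun i : (Σ (g g' : G) (_ : g ⟶ g'), M.obj.obj (op g')) => F.obj i.1) ⟶ gens F M :=
  Sigma.desc fun i => gen F M i.1 (M.obj.map i.2.2.1.op i.2.2.2) -
    F.map i.2.2.1 ≫ gen F M i.2.1 i.2.2.2

/-- The relations `(m + m') ⊗ - = m ⊗ - + m' ⊗ -`, for `m, m' ∈ M g`. -/
abbrev relAdd :
    (∐ fun i : (Σ g : G, M.obj.obj (op g) × M.obj.obj (op g)) => F.obj i.1) ⟶ gens F M :=
  Sigma.desc fun i => gen F M i.1 (i.2.1 + i.2.2) - (gen F M i.1 i.2.1 + gen F M i.1 i.2.2)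

/-- The tensor product `M ⊗_G F`, given by generators and relations. -/
def obj : A := cokernel (coprod.desc (relMap F M) (relAdd F M))

def ι (g : G) (m : M.obj.obj (op g)) : F.obj g ⟶ obj F M := gen F M g m ≫ cokernel.π _

lemma ι_map {g g' : G} (f : g ⟶ g') (m : M.obj.obj (op g')) :
    ι F M g (M.obj.map f.op m) = F.map f ≫ ι F M g' m := by
  have h := coprod.inl ≫= cokernel.condition (coprod.desc (relMap F M) (relAdd F M))
  rw [coprod.inl_desc_assoc] at h
  have h' := Sigma.ι (fun i : (Σ (g g' : G) (_ : g ⟶ g'), M.obj.obj (op g')) => F.obj i.1)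
    ⟨g, g', f, m⟩ ≫= h
  rw [Sigma.ι_desc_assoc, Preadditive.sub_comp, comp_zero, comp_zero, sub_eq_zero,
    Category.assoc] at h'
  exact h'

lemma ι_add (g : G) (m m' : M.obj.obj (op g)) :
    ι F M g (m + m') = ι F M g m + ι F M g m' := by
  have h := coprod.inr ≫= cokernel.condition (coprod.desc (relMap F M) (relAdd F M))
  rw [coprod.inr_desc_assoc] at h
  have h' := Sigma.ι (fun i : (Σ g : G, M.obj.obj (op g) × M.obj.obj (op g)) => F.obj i.1)
    ⟨g, m, m'⟩ ≫= h
  rw [Sigma.ι_desc_assoc, Preadditive.sub_comp, comp_zero, comp_zero, sub_eq_zero,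
    Preadditive.add_comp] at h'
  exact h'

variable {F M}

lemma hom_ext {X : A} {φ ψ : obj F M ⟶ X}
    (h : ∀ (g : G) (m : M.obj.obj (op g)), ι F M g m ≫ φ = ι F M g m ≫ ψ) : φ = ψ := by
  apply (cancel_epi (cokernel.π _)).1
  refine Sigma.hom_ext _ _ fun i => ?_
  exact (Category.assoc _ _ _).symm.trans ((h i.1 i.2).trans (Category.assoc _ _ _))

/-- The value at `m ∈ M g` of a homomorphism `M ⟶ A(F -, X)`. -/
def ev [F.Additive] {X : A} (η : M ⟶ (homRestriction F).obj X) (g : G) (m : M.obj.obj (op g)) :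
    F.obj g ⟶ X := η.hom.app (op g) m

def desc [F.Additive] {X : A} (η : M ⟶ (homRestriction F).obj X) : obj F M ⟶ X :=
  cokernel.desc _ (Sigma.desc fun i => ev η i.1 i.2) (by
    apply coprod.hom_ext
    · refine Sigma.hom_ext _ _ fun i => ?_
      have h : ev η i.1 (M.obj.map i.2.2.1.op i.2.2.2) = F.map i.2.2.1 ≫ ev η i.2.1 i.2.2.2 :=
        ConcreteCategory.congr_hom (η.hom.naturality i.2.2.1.op) i.2.2.2
      rw [coprod.inl_desc_assoc, Sigma.ι_desc_assoc, Preadditive.sub_comp, Category.assoc,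
        Sigma.ι_desc, Sigma.ι_desc, h, sub_self, comp_zero, comp_zero]
    · refine Sigma.hom_ext _ _ fun i => ?_
      have h : ev η i.1 (i.2.1 + i.2.2) = ev η i.1 i.2.1 + ev η i.1 i.2.2 :=
        map_add (η.hom.app (op i.1)).hom i.2.1 i.2.2
      rw [coprod.inr_desc_assoc, Sigma.ι_desc_assoc, Preadditive.sub_comp, Preadditive.add_comp,
        Sigma.ι_desc, Sigma.ι_desc, Sigma.ι_desc, h, sub_self, comp_zero, comp_zero])

lemma ι_desc [F.Additive] {X : A} (η : M ⟶ (homRestriction F).obj X) (g : G) (m : M.obj.obj (op g)) :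
    ι F M g m ≫ desc η = ev η g m := by
  exact (Category.assoc _ _ _).trans ((congrArg (gen F M g m ≫ ·)
    (cokernel.π_desc _ _ _)).trans (Sigma.ι_desc _ _))

variable (F M)

/-- The adjunction isomorphism `A(M ⊗_G F, X) ≃ Hom_G(M, A(F -, X))`. -/
def homEquiv [F.Additive] (X : A) : (obj F M ⟶ X) ≃ (M ⟶ (homRestriction F).obj X) where
  toFun φ := ObjectProperty.homMk
    { app g := AddCommGrpCat.ofHom (AddMonoidHom.mk' (fun m => ι F M g.unop m ≫ φ)
        (fun m m' => by
          rw [show ι F M g.unop (m + m') = _ from ι_add F M g.unop m m']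
          exact Preadditive.add_comp _ _ _ _ _ _))
      naturality g g' f := by
        ext m
        exact (congrArg (· ≫ φ) (ι_map F M f.unop m)).trans (Category.assoc _ _ _) }
  invFun η := desc η
  left_inv φ := hom_ext fun g m => ι_desc _ g m
  right_inv η := by
    ext : 1
    ext g m
    exact ι_desc η g.unop m

end Induction

variable [F.Additive]

/-- The induction functor `F^* : ModCat G ⥤ A`, `M ↦ M ⊗_G F`, of an additive functor `F : G ⥤ A`.
By the next declarations it is left adjoint to `F_*` (hence preserves colimits) and sends `G(-, g)`
to `F g`; this determines it up to natural isomorphism. -/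
def induction : ModCat G ⥤ A :=
  Adjunction.leftAdjointOfEquiv (G := homRestriction F) (F_obj := Induction.obj F)
    (fun M X => Induction.homEquiv F M X) (by
      intro M X Y g h
      ext : 1
      ext x m
      exact (Category.assoc _ _ _).symm)

def inductionAdjunction : induction F ⊣ homRestriction F :=
  Adjunction.adjunctionOfEquivLeft _ _

instance : (induction F).IsLeftAdjoint := (inductionAdjunction F).isLeftAdjoint

instance : (induction F).Additive := (inductionAdjunction F).left_adjoint_additive

/-- `F^* G(-, g) ≅ F g`. -/
def inductionObjRepresentable (g : G) : (induction F).obj (representable g) ≅ F.obj g :=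
  let η : representable g ⟶ (homRestriction F).obj (F.obj g) := ObjectProperty.homMk
    { app g' := AddCommGrpCat.ofHom
        (AddMonoidHom.mk' (fun m : g'.unop ⟶ g => F.map m) (fun _ _ => F.map_add))
      naturality _ _ f := by
        ext m
        exact F.map_comp _ _ }
  { hom := Induction.desc η
    inv := Induction.ι F (representable g) g (𝟙 g)
    hom_inv_id := Induction.hom_ext fun g' m => by
      refine (Category.assoc _ _ _).symm.trans ?_
      refine (congrArg (· ≫ Induction.ι F (representable g) g (𝟙 g))
        (Induction.ι_desc η g' m)).trans ?_
      refine (Induction.ι_map F (representable g) (show g' ⟶ g from m) (𝟙 g)).symm.trans ?_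
      refine (congrArg (Induction.ι F (representable g) g')
        (Category.comp_id (show g' ⟶ g from m))).trans ?_
      exact (Category.comp_id _).symm
    inv_hom_id := (Induction.ι_desc η g (𝟙 g)).trans (F.map_id g) }

end Induction

section Quotient

variable {C : Type u} [Category.{w} C] [Abelian C]

/-- A localizing subcategory of an abelian category: a full subcategory closed under subobjects,
quotients, extensions and (small) direct sums. -/
class IsLocalizing (L : ObjectProperty C) : Prop extends L.IsSerreClass where
  isClosedUnderCoproducts (J : Type w) : L.IsClosedUnderColimitsOfShape (Discrete J)

attribute [instance] IsLocalizing.isClosedUnderCoproducts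

variable (L : ObjectProperty C) [IsLocalizing L]

/-- The quotient category `C / L`: the localization of `C` at the morphisms with kernel and
cokernel in `L`. -/
abbrev QuotientCategory : Type u := L.isoModSerre.Localization

/-- The quotient functor `Q : C ⥤ C / L`. -/
abbrev quotientFunctor : C ⥤ QuotientCategory L := L.isoModSerre.Q

section Coproducts

variable [HasColimitsOfSize.{w, w} C]

lemma isoModSerre_colimMap [AB4OfSize.{w} C] {J : Type w} {X Y : Discrete J ⥤ C} (α : X ⟶ Y)
    (hα : ∀ j, L.isoModSerre (α.app j)) : L.isoModSerre (colimMap α) := by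
  have : PreservesFiniteLimits (colim (J := Discrete J) (C := C)) :=
    HasExactColimitsOfShape.preservesFiniteLimits
  constructor
  · have h := (ShortComplex.exact_kernel α).map (colim (J := Discrete J) (C := C))
    rw [ShortComplex.exact_iff_epi_kernel_lift] at h
    refine @ObjectProperty.prop_of_epi _ _ L _ _ _ _ h ?_
    refine L.prop_colimit _ fun j => ?_
    exact L.prop_of_iso (PreservesKernel.iso ((evaluation _ _).obj j) α).symm (hα j).1
  · have h := (ShortComplex.exact_cokernel α).map (colim (J := Discrete J) (C := C))
    rw [ShortComplex.exact_iff_mono_cokernel_desc] at h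
    refine @ObjectProperty.prop_of_mono _ _ L _ _ _ _ h ?_
    refine L.prop_colimit _ fun j => ?_
    exact L.prop_of_iso (PreservesCokernel.iso ((evaluation _ _).obj j) α).symm (hα j).2

lemma eq_zero_of_comp {J : Type w} (K : Discrete J ⥤ C) {Z : QuotientCategory L}
    (d : (quotientFunctor L).obj (colimit K) ⟶ Z)
    (hd : ∀ j, (quotientFunctor L).map (colimit.ι K j) ≫ d = 0) : d = 0 := by
  obtain ⟨N, ⟨e⟩⟩ := (Localization.essSurj (quotientFunctor L) L.isoModSerre).mem_essImage Z
  obtain ⟨r, hr⟩ := Localization.exists_leftFraction (quotientFunctor L) L.isoModSerre (d ≫ e.inv)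
  have hr' : d ≫ e.inv ≫ (quotientFunctor L).map r.s = (quotientFunctor L).map r.f := by
    rw [← Category.assoc, hr, MorphismProperty.LeftFraction.map_comp_map_s]
  have : IsIso ((quotientFunctor L).map r.s) := Localization.inverts _ L.isoModSerre _ r.hs
  rw [← cancel_mono (e.inv ≫ (quotientFunctor L).map r.s), zero_comp, hr']
  have hT (j : Discrete J) : L (Abelian.image (colimit.ι K j ≫ r.f)) := by
    rw [← ObjectProperty.SerreClassLocalization.map_eq_zero_iff (quotientFunctor L) L,
      Functor.map_comp, ← hr', reassoc_of% hd j, zero_comp]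
  let T : Discrete J ⥤ C := Discrete.functor fun j => Abelian.image (colimit.ι K ⟨j⟩ ≫ r.f)
  let u : K ⟶ T := Discrete.natTrans fun j => Abelian.factorThruImage (colimit.ι K j ≫ r.f)
  let c : Cocone T :=
    { pt := r.Y'
      ι := Discrete.natTrans fun j => Abelian.image.ι (colimit.ι K j ≫ r.f) }
  have huv : r.f = colimMap u ≫ colimit.desc T c := by
    refine colimit.hom_ext fun j => ?_
    rw [ι_colimMap_assoc, colimit.ι_desc]
    exact (Abelian.image.fac _).symm
  have hz : IsZero ((quotientFunctor L).obj (colimit T)) := by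
    rw [ObjectProperty.SerreClassLocalization.isZero_obj_iff (quotientFunctor L) L]
    exact L.prop_colimit _ fun j => hT j
  rw [huv, Functor.map_comp, hz.eq_of_tgt ((quotientFunctor L).map (colimMap u)) 0, zero_comp]

lemma exists_desc [AB4OfSize.{w} C] {J : Type w} (K : Discrete J ⥤ C)
    (s : Cocone (K ⋙ quotientFunctor L)) :
    ∃ d : (quotientFunctor L).obj (colimit K) ⟶ s.pt,
      ∀ j, (quotientFunctor L).map (colimit.ι K j) ≫ d = s.ι.app j := by
  obtain ⟨N, ⟨e⟩⟩ := (Localization.essSurj (quotientFunctor L) L.isoModSerre).mem_essImage s.pt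
  choose r hr using fun j => Localization.exists_rightFraction (quotientFunctor L) L.isoModSerre
    (X := K.obj j) (s.ι.app j ≫ e.inv)
  let K' : Discrete J ⥤ C := Discrete.functor fun j => (r ⟨j⟩).X'
  let α : K' ⟶ K := Discrete.natTrans fun j => (r j).s
  have : IsIso ((quotientFunctor L).map (colimMap α)) :=
    Localization.inverts _ L.isoModSerre _ (isoModSerre_colimMap L α fun j => (r j).hs)
  let c : Cocone K' := { pt := N, ι := Discrete.natTrans fun j => (r j).f }
  refine ⟨inv ((quotientFunctor L).map (colimMap α)) ≫
    (quotientFunctor L).map (colimit.desc K' c) ≫ e.hom, fun j => ?_⟩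
  have : IsIso ((quotientFunctor L).map (r j).s) := Localization.inverts _ L.isoModSerre _ (r j).hs
  have h1 : (r j).s ≫ colimit.ι K j = colimit.ι K' j ≫ colimMap α := (ι_colimMap α j).symm
  have h2 : colimit.ι K' j ≫ colimit.desc K' c = (r j).f := colimit.ι_desc c j
  rw [← cancel_epi ((quotientFunctor L).map (r j).s), ← Functor.map_comp_assoc, h1,
    Functor.map_comp_assoc, IsIso.hom_inv_id_assoc, ← Functor.map_comp_assoc, h2,
    ← cancel_mono e.inv]
  have := hr j
  rw [Category.assoc, Category.assoc, this, MorphismProperty.RightFraction.map_s_comp_map,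
    e.hom_inv_id, Category.comp_id]

instance [AB4OfSize.{w} C] : PreservesColimitsOfSize.{w, w} (quotientFunctor L) := by
  have (J : Type w) : PreservesColimitsOfShape (Discrete J) (quotientFunctor L) := ⟨fun {K} =>
    preservesColimit_of_preserves_colimit_cocone (colimit.isColimit K)
      (IsColimit.ofExistsUnique fun s => by
        obtain ⟨d, hd⟩ := exists_desc L K s
        refine ⟨d, hd, fun d' hd' => sub_eq_zero.1 (eq_zero_of_comp L K _ fun j => ?_)⟩
        rw [Preadditive.comp_sub, hd]
        exact sub_eq_zero.2 (hd' j))⟩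
  have {X Y : C} (f : X ⟶ Y) :=
    ObjectProperty.SerreClassLocalization.preservesCokernel (quotientFunctor L) L f
  have : PreservesColimitsOfShape WalkingParallelPair (quotientFunctor L) :=
    Functor.preservesCoequalizers_of_preservesCokernels _
  exact preservesColimits_of_preservesCoequalizers_and_coproducts _

end Coproducts

/-- The quotient category has small hom sets. -/
lemma locallySmall_quotient [WellPowered.{w} C] : LocallySmall.{w} (QuotientCategory L) := by
  have key (X Y : C) : Small.{w} ((quotientFunctor L).obj X ⟶ (quotientFunctor L).obj Y) := by
    let I := Σ (A : Subobject X) (B : Subobject Y), ((A : C) ⟶ cokernel B.arrow)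
    let φ : I → ((quotientFunctor L).obj X ⟶ (quotientFunctor L).obj Y) := fun i => by
      classical
      exact if h : IsIso ((quotientFunctor L).map i.1.arrow) ∧
          IsIso ((quotientFunctor L).map (cokernel.π i.2.1.arrow)) then
        letI := h.1
        letI := h.2
        inv ((quotientFunctor L).map i.1.arrow) ≫ (quotientFunctor L).map i.2.2 ≫
          inv ((quotientFunctor L).map (cokernel.π i.2.1.arrow)) else 0
    refine small_of_surjective (f := φ) fun t => ?_
    obtain ⟨r, rfl⟩ := Localization.exists_rightFraction (quotientFunctor L) L.isoModSerre t
    let A := imageSubobject r.s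
    let p : r.X' ⟶ (A : C) := factorThruImageSubobject r.s
    have hp : p ≫ A.arrow = r.s := imageSubobject_arrow_comp r.s
    let B := imageSubobject (kernel.ι r.s ≫ r.f)
    have hB : kernel.ι r.s ≫ r.f ≫ cokernel.π B.arrow = 0 := by
      rw [← Category.assoc, ← imageSubobject_arrow_comp (kernel.ι r.s ≫ r.f), Category.assoc,
        cokernel.condition, comp_zero]
    have hk : kernel.ι p ≫ r.f ≫ cokernel.π B.arrow = 0 := by
      have h : kernel.ι p ≫ r.s = 0 := by rw [← hp, kernel.condition_assoc, zero_comp]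
      rw [← kernel.lift_ι r.s _ h, Category.assoc, hB, comp_zero]
    let g : (A : C) ⟶ cokernel B.arrow := Abelian.epiDesc p (r.f ≫ cokernel.π B.arrow) hk
    have hg : p ≫ g = r.f ≫ cokernel.π B.arrow := Abelian.comp_epiDesc _ _ _
    have hs : IsIso ((quotientFunctor L).map r.s) := Localization.inverts _ L.isoModSerre _ r.hs
    have hA : IsIso ((quotientFunctor L).map A.arrow) := by
      have := ObjectProperty.SerreClassLocalization.preservesMonomorphisms (quotientFunctor L) L
      have : IsSplitEpi ((quotientFunctor L).map A.arrow) := ⟨⟨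
        { section_ := inv ((quotientFunctor L).map r.s) ≫ (quotientFunctor L).map p
          id := by rw [Category.assoc, ← Functor.map_comp, hp, IsIso.inv_hom_id] }⟩⟩
      exact isIso_of_mono_of_isSplitEpi _
    have hπ : IsIso ((quotientFunctor L).map (cokernel.π B.arrow)) := by
      refine Localization.inverts _ L.isoModSerre _ (L.isoModSerre_of_epi _ ?_)
      have h1 : L (B : C) := L.prop_of_epi (factorThruImageSubobject (kernel.ι r.s ≫ r.f)) r.hs.1
      exact L.prop_of_epi (Abelian.factorThruImage B.arrow) h1
    refine ⟨⟨A, B, g⟩, ?_⟩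
    have hφ : φ ⟨A, B, g⟩ = inv ((quotientFunctor L).map A.arrow) ≫ (quotientFunctor L).map g ≫
        inv ((quotientFunctor L).map (cokernel.π B.arrow)) := dif_pos ⟨hA, hπ⟩
    rw [hφ, ← cancel_epi ((quotientFunctor L).map r.s),
      MorphismProperty.RightFraction.map_s_comp_map, ← hp, Functor.map_comp, Category.assoc,
      IsIso.hom_inv_id_assoc, ← Functor.map_comp_assoc, hg, Functor.map_comp_assoc,
      IsIso.hom_inv_id, Category.comp_id]
  refine ⟨fun X Y => ?_⟩
  obtain ⟨X', ⟨eX⟩⟩ := (Localization.essSurj (quotientFunctor L) L.isoModSerre).mem_essImage X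
  obtain ⟨Y', ⟨eY⟩⟩ := (Localization.essSurj (quotientFunctor L) L.isoModSerre).mem_essImage Y
  have := key X' Y'
  exact small_map (Iso.homCongr eX eY).symm

/-- The quotient functor of a Grothendieck category has a right adjoint. -/
instance [IsGrothendieckAbelian.{w} C] : (quotientFunctor L).IsLeftAdjoint := by
  have := locallySmall_quotient L
  have : PreservesColimits (quotientFunctor L ⋙ (ShrinkHoms.equivalence.{w} _).functor) :=
    inferInstance
  have h := isLeftAdjoint_of_preservesColimits_of_isSeparating
    (isSeparator_separator C) (quotientFunctor L ⋙ (ShrinkHoms.equivalence.{w} _).functor)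
  exact Functor.isLeftAdjoint_of_iso
    (F := (quotientFunctor L ⋙ (ShrinkHoms.equivalence.{w} _).functor) ⋙
      (ShrinkHoms.equivalence.{w} _).inverse)
    (Functor.associator _ _ _ ≪≫
      Functor.isoWhiskerLeft _ (ShrinkHoms.equivalence.{w} _).unitIso.symm ≪≫
      Functor.rightUnitor _)

/-- The right adjoint `R : C / L ⥤ C` of the quotient functor. -/
def sectionFunctor [IsGrothendieckAbelian.{w} C] : QuotientCategory L ⥤ C :=
  (quotientFunctor L).rightAdjoint

/-- The adjunction between `Q` and `R`. -/
def sectionAdjunction [IsGrothendieckAbelian.{w} C] : quotientFunctor L ⊣ sectionFunctor L :=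
  Adjunction.ofIsLeftAdjoint _

end Quotient

section Localizing

variable {G : Type w} [SmallCategory G] [Preadditive G]

variable (L : ObjectProperty (ModCat G))

/-- A module `X` is `L`-closed if `Hom(M, X) = 0 = Ext¹(M, X)` for all `M` in `L`. -/
def IsClosedModule (X : ModCat G) : Prop :=
  ∀ M : ModCat G, L M → Subsingleton (M ⟶ X) ∧ Subsingleton (Abelian.Ext.{w} M X 1)

/-- A functor `F : G ⥤ A` into a cocomplete abelian category is generalized `L`-closed if `F^*`
annihilates `L` and preserves exactness of the sequences `0 ⟶ M ⟶ N ⟶ T ⟶ 0` with `T` in `L`. -/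
structure IsGeneralizedClosed {A : Type a} [Category.{w} A] [Abelian A]
    [HasColimitsOfSize.{w, w} A] (F : G ⥤ A) [F.Additive] : Prop where
  isZero (M : ModCat G) (hM : L M) : IsZero ((induction F).obj M)
  shortExact (E : ShortComplex (ModCat G)) (hE : E.ShortExact) (hL : L E.X₃) :
    (E.map (induction F)).ShortExact

/-- `S : U ⥤ G` is an `L`-conditioned epimorphism if `F ∘ S = F' ∘ S` implies `F = F'` for all
additive functors `F, F'` from `G` to a cocomplete abelian category, with `F` generalized
`L`-closed. -/
def IsConditionedEpi {U : Type w} [SmallCategory U] [Preadditive U] (S : U ⥤ G) : Prop :=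
  ∀ (A : Type a) [Category.{w} A] [Abelian A] [HasColimitsOfSize.{w, w} A]
    (F F' : G ⥤ A) [F.Additive] [F'.Additive],
    IsGeneralizedClosed L F → S ⋙ F = S ⋙ F' → F = F'


end Localizing

end SeveralObjects

end

open SeveralObjects

/-! Everything is phrased through modules local for the morphisms with kernel and cokernel in `L`.
Closed modules are local, up to isomorphism the local modules are the values of `R`, and `R` is
fully faithful. Restriction along `S` is faithful because `S` is surjective on objects. So (i) and
(ii) both say that every `U`-linear map between local `G`-modules is `G`-linear. By adjunction, `F`
is generalized closed exactly when all the modules `A(F -, X)` are local.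

From fullness to the epimorphism property: if `F` and `F'` agree on `U`, then `m ↦ F' m` is a
`U`-linear map from `G(-, g')` to `A(F -, F g')`. Both modules are local, so the map is `G`-linear,
and its value at the identity forces `F' m = F m` (`isConditionedEpi_of_surjective_map`).

Conversely, let `φ` be a `U`-linear map between local modules `X` and `Y`. On `W = X ⊞ Y` it gives a
square-zero family `n`, and conjugating `W` by `1 + n` gives a second functor that agrees with `W`
on `U`. Viewed as a functor from `G` to the cocomplete abelian category `Abᵒᵖ`, `W` is generalized
closed, because `Hom(B, W -)` is local whenever `W` is. Hence the two functors coincide, which says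
that `n`, and with it `φ`, is `G`-linear (`IsConditionedEpi.natural`,
`IsConditionedEpi.surjective_map`). -/

namespace SeveralObjects

/-! ### Local objects for a Serre class and the right adjoint of the quotient functor. -/

section Local

variable {C : Type u} [Category.{v} C] [Abelian C] (P : ObjectProperty C) [P.IsSerreClass]

/-- A morphism with kernel and cokernel in `P` is an epimorphism with kernel in `P` followed by a
monomorphism with cokernel in `P`. Maps to `Z` descend along the first by `h₀` and extend along the
second by `h₁`. -/
lemma isLocal_of_shortExact {Z : C} (h₀ : ∀ M, P M → ∀ f : M ⟶ Z, f = 0)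
    (h₁ : ∀ E : ShortComplex C, E.ShortExact → P E.X₃ →
      ∀ f : E.X₁ ⟶ Z, ∃ f' : E.X₂ ⟶ Z, E.f ≫ f' = f) :
    P.isoModSerre.isLocal Z := by
  intro M N s hs
  refine ⟨fun f f' h => ?_, fun f => ?_⟩
  · have h' : s ≫ (f - f') = 0 := by
      rw [Preadditive.comp_sub]
      exact sub_eq_zero.2 h
    rw [← sub_eq_zero, ← cokernel.π_desc s _ h', h₀ _ hs.2 (cokernel.desc s _ h'), comp_zero]
  · have hf : kernel.ι s ≫ f = 0 := h₀ _ hs.1 _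
    let j := Abelian.factorThruCoimage s
    -- The cokernel of `j` is a quotient of the cokernel of `s`.
    have hj : P (cokernel j) := by
      have h : s ≫ cokernel.π j = 0 := by
        refine (congrArg (· ≫ cokernel.π j) (Abelian.coimage.fac s)).symm.trans ?_
        change (Abelian.coimage.π s ≫ j) ≫ cokernel.π j = 0
        rw [Category.assoc, cokernel.condition, comp_zero]
      have : Epi (cokernel.desc s (cokernel.π j) h) := by
        have : Epi (cokernel.π s ≫ cokernel.desc s (cokernel.π j) h) := by
          rw [cokernel.π_desc]
          infer_instance
        exact epi_of_epi (cokernel.π s) _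
      exact P.prop_of_epi (cokernel.desc s (cokernel.π j) h) hs.2
    obtain ⟨f', hf'⟩ := h₁ (ShortComplex.mk j (cokernel.π j) (cokernel.condition j))
      { exact := ShortComplex.exact_cokernel j } hj (cokernel.desc _ f hf)
    refine ⟨f', ?_⟩
    change s ≫ f' = f
    have h := cokernel.π_desc (kernel.ι s) f hf
    rw [← hf'] at h
    rw [← h, ← Category.assoc]
    exact congrArg (· ≫ f') (Abelian.coimage.fac s).symm

variable {P}

/-- Calculus of fractions: a morphism in the quotient is a fraction `N ⟵ N' ⟶ X`, and by locality of
`X` its numerator extends uniquely along its denominator. -/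
lemma quotientFunctor_map_bijective {N X : C} (hX : P.isoModSerre.isLocal X) :
    Function.Bijective (fun f : N ⟶ X => P.isoModSerre.Q.map f) := by
  refine ⟨fun f f' h => ?_, fun t => ?_⟩
  · obtain ⟨Z, s, hs, h'⟩ :=
      (MorphismProperty.map_eq_iff_precomp P.isoModSerre.Q P.isoModSerre f f').1 h
    exact (hX s hs).1 h'
  · obtain ⟨r, rfl⟩ := Localization.exists_rightFraction P.isoModSerre.Q P.isoModSerre t
    obtain ⟨f, hf⟩ := (hX r.s r.hs).2 r.f
    refine ⟨f, ?_⟩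
    have := Localization.inverts P.isoModSerre.Q P.isoModSerre r.s r.hs
    rw [← cancel_epi (P.isoModSerre.Q.map r.s), MorphismProperty.RightFraction.map_s_comp_map,
      ← hf, ← Functor.map_comp]

lemma isLocal_rightAdjoint_obj {R : P.isoModSerre.Localization ⥤ C} (adj : P.isoModSerre.Q ⊣ R)
    (A : P.isoModSerre.Localization) : P.isoModSerre.isLocal (R.obj A) := by
  intro M N s hs
  have := Localization.inverts P.isoModSerre.Q P.isoModSerre s hs
  have h : Function.Bijective fun t : P.isoModSerre.Q.obj N ⟶ A => P.isoModSerre.Q.map s ≫ t :=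
    (isIso_iff_coyoneda_map_bijective _).1 this A
  convert ((adj.homEquiv M A).bijective.comp h).comp (adj.homEquiv N A).symm.bijective using 1
  ext f
  simp [Adjunction.homEquiv_naturality_left]

/-- By essential surjectivity of `Q` it is enough to test on objects `Q N`. There the composite
`Hom(N, R A) ⟶ Hom(Q N, Q R A) ⟶ Hom(Q N, A)` is the adjunction bijection, and its first map is
bijective because `R A` is local. -/
lemma isIso_counit {R : P.isoModSerre.Localization ⥤ C} (adj : P.isoModSerre.Q ⊣ R) :
    IsIso adj.counit := by
  have (A : P.isoModSerre.Localization) : IsIso (adj.counit.app A) := by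
    refine isIso_of_yoneda_map_bijective _ fun T => ?_
    obtain ⟨N, ⟨e⟩⟩ := (Localization.essSurj P.isoModSerre.Q P.isoModSerre).mem_essImage T
    have h : Function.Bijective fun t : P.isoModSerre.Q.obj N ⟶ P.isoModSerre.Q.obj (R.obj A) =>
        t ≫ adj.counit.app A := by
      refine (Function.Bijective.of_comp_iff _
        (quotientFunctor_map_bijective (N := N) (isLocal_rightAdjoint_obj adj A))).1 ?_
      have h : _ = ⇑(adj.homEquiv N A).symm := funext fun f => (adj.homEquiv_counit (g := f)).symm
      exact (congrArg Function.Bijective h).mpr (adj.homEquiv N A).symm.bijective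
    refine ⟨fun f f' hf => ?_, fun f => ?_⟩
    · refine (cancel_epi e.hom).1 (h.1 ?_)
      simpa using e.hom ≫= hf
    · obtain ⟨t, ht⟩ := h.2 (e.hom ≫ f)
      refine ⟨e.inv ≫ t, ?_⟩
      simpa using e.inv ≫= ht
  exact NatIso.isIso_of_isIso_app _

lemma isIso_unit_app {R : P.isoModSerre.Localization ⥤ C} (adj : P.isoModSerre.Q ⊣ R) {X : C}
    (hX : P.isoModSerre.isLocal X) : IsIso (adj.unit.app X) := by
  refine isIso_of_yoneda_map_bijective _ fun T => ?_
  have h : (fun f : T ⟶ X => f ≫ adj.unit.app X) =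
      adj.homEquiv T (P.isoModSerre.Q.obj X) ∘ fun f => P.isoModSerre.Q.map f :=
    funext fun f => by simp [Adjunction.homEquiv_unit]
  refine h ▸ (adj.homEquiv T _).bijective.comp (quotientFunctor_map_bijective hX)

end Local

/-! ### Closed modules and generalized closed functors in terms of locality. -/

section Module

variable {G : Type w} [SmallCategory G] [Preadditive G] {L : ObjectProperty (ModCat G)}

/-- In the long exact sequence of `Ext(-, X)`, the obstruction to extending a map lies in
`Ext¹(E.X₃, X) = 0`. -/
lemma IsClosedModule.isLocal [L.IsSerreClass] {X : ModCat G} (hX : IsClosedModule L X) :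
    L.isoModSerre.isLocal X := by
  refine isLocal_of_shortExact L (fun M hM f => (hX M hM).1.elim _ _) fun E hE hE₃ f => ?_
  obtain ⟨y, hy⟩ := Abelian.Ext.contravariant_sequence_exact₁ hE X (Abelian.Ext.mk₀ f) (add_zero 1)
    ((hX _ hE₃).2.elim _ _)
  obtain ⟨f', rfl⟩ := (Abelian.Ext.mk₀_bijective _ _).2 y
  refine ⟨f', (Abelian.Ext.mk₀_bijective _ _).1 ?_⟩
  rw [← hy, Abelian.Ext.mk₀_comp_mk₀]

variable {A : Type a} [Category.{w} A] [Abelian A] [HasColimitsOfSize.{w, w} A]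
  {F : G ⥤ A} [F.Additive]

/-- The functor `F^*` inverts a monomorphism whose cokernel is in `L`: its image is mono by
exactness, and epi because the third term becomes zero. Maps to `A(F -, X)` therefore extend, by
adjunction. -/
lemma IsGeneralizedClosed.isLocal [L.IsSerreClass] (hF : IsGeneralizedClosed L F) (X : A) :
    L.isoModSerre.isLocal ((homRestriction F).obj X) := by
  let adj := inductionAdjunction F
  refine isLocal_of_shortExact L (fun M hM f => ?_) fun E hE hE₃ f => ?_
  · exact (adj.homEquiv _ _).symm.injective ((hF.isZero M hM).eq_of_src _ _)
  · have h := hF.shortExact E hE hE₃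
    have := h.mono_f
    have : Epi (E.map (induction F)).f := h.exact.epi_f ((hF.isZero _ hE₃).eq_of_tgt _ _)
    have : IsIso ((induction F).map E.f) := isIso_of_mono_of_epi (E.map (induction F)).f
    refine ⟨adj.homEquiv _ _ (inv ((induction F).map E.f) ≫ (adj.homEquiv _ _).symm f), ?_⟩
    rw [← Adjunction.homEquiv_naturality_left, IsIso.hom_inv_id_assoc, Equiv.apply_symm_apply]

/-- Locality of all `A(F -, X)` means, by adjunction and Yoneda, that `F^*` inverts the morphisms
with kernel and cokernel in `L`. -/
lemma isGeneralizedClosed_of_isLocal [L.IsSerreClass]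
    (hF : ∀ X : A, L.isoModSerre.isLocal ((homRestriction F).obj X)) :
    IsGeneralizedClosed L F := by
  let adj := inductionAdjunction F
  have hs {M N : ModCat G} (s : M ⟶ N) (hs : L.isoModSerre s) : IsIso ((induction F).map s) := by
    refine isIso_of_coyoneda_map_bijective _ fun X => ?_
    convert ((adj.homEquiv M X).symm.bijective.comp (hF X s hs)).comp
      (adj.homEquiv N X).bijective using 1
    ext f
    simp [Adjunction.homEquiv_naturality_left_symm]
  have h₀ (M : ModCat G) (hM : L M) : IsZero ((induction F).obj M) := by
    -- For `M` in `L` even the zero endomorphism is inverted, which forces `F^* M = 0`.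
    have h : IsIso ((induction F).map (0 : M ⟶ M)) :=
      hs _ ((L.isoModSerre_zero_iff M M).2 ⟨hM, hM⟩)
    rw [Functor.map_zero] at h
    exact (IsZero.iff_id_eq_zero _).2
      ((cancel_mono (0 : (induction F).obj M ⟶ (induction F).obj M)).1 (by simp))
  refine ⟨h₀, fun E hE hE₃ => ?_⟩
  have := hE.mono_f
  have : IsIso ((induction F).map E.f) := hs E.f (L.isoModSerre_of_mono _
    (L.prop_of_iso (hE.gIsCokernel.coconePointUniqueUpToIso (colimit.isColimit _)) hE₃))
  have h := h₀ _ hE₃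
  have : Epi (E.map (induction F)).f := inferInstanceAs (Epi ((induction F).map E.f))
  exact
    { exact := (ShortComplex.exact_iff_epi _ (h.eq_of_tgt _ _)).2 this
      mono_f := inferInstanceAs (Mono ((induction F).map E.f))
      epi_g := ⟨fun _ _ _ => h.eq_of_src _ _⟩ }

end Module

/-! ### Fullness of `S_* ∘ R`, and why it makes `S` a conditioned epimorphism. -/

section Restriction

variable {U G : Type w} [SmallCategory U] [Preadditive U] [SmallCategory G] [Preadditive G]
  (S : U ⥤ G) [S.Additive]

lemma restriction_faithful (hS : Function.Surjective S.obj) : (restriction S).Faithful where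
  map_injective {X Y f f'} h := by
    ext : 1
    ext g : 2
    obtain ⟨u, hu⟩ := hS g.unop
    obtain rfl : g = op (S.obj u) := congrArg op hu.symm
    exact NatTrans.congr_app (congrArg (·.hom) h) (op u)

variable {S} {L : ObjectProperty (ModCat G)} [IsLocalizing L]

instance : (sectionFunctor L).Full :=
  have := isIso_counit (sectionAdjunction L)
  (sectionAdjunction L).fullyFaithfulROfIsIsoCounit.full

instance : (sectionFunctor L).Faithful :=
  have := isIso_counit (sectionAdjunction L)
  (sectionAdjunction L).fullyFaithfulROfIsIsoCounit.faithful

lemma full_section_restriction_iff : (sectionFunctor L ⋙ restriction S).Full ↔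
    ∀ X Y : ModCat G, L.isoModSerre.isLocal X → L.isoModSerre.isLocal Y →
      Function.Surjective ((restriction S).map : (X ⟶ Y) → _) := by
  refine ⟨fun h X Y hX hY φ => ?_, fun h => ⟨fun {A B} φ => ?_⟩⟩
  · have := isIso_unit_app (sectionAdjunction L) hX
    have := isIso_unit_app (sectionAdjunction L) hY
    let i := asIso ((sectionAdjunction L).unit.app X)
    let j := asIso ((sectionAdjunction L).unit.app Y)
    obtain ⟨t, ht⟩ := h.map_surjective
      ((restriction S).map i.inv ≫ φ ≫ (restriction S).map j.hom)
    refine ⟨i.hom ≫ (sectionFunctor L).map t ≫ j.inv, ?_⟩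
    rw [Functor.map_comp, Functor.map_comp]
    refine (congrArg (fun t => (restriction S).map i.hom ≫ t ≫ (restriction S).map j.inv)
      ht).trans ?_
    simp [← Functor.map_comp, ← Functor.map_comp_assoc]
  · obtain ⟨f, hf⟩ := h _ _ (isLocal_rightAdjoint_obj (sectionAdjunction L) A)
      (isLocal_rightAdjoint_obj (sectionAdjunction L) B) φ
    obtain ⟨t, rfl⟩ := (sectionFunctor L).map_surjective f
    exact ⟨t, hf⟩

lemma isConditionedEpi_of_surjective_map (hS : Function.Surjective S.obj)
    (hL : ∀ g : G, L.isoModSerre.isLocal (representable g))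
    (h : ∀ X Y : ModCat G, L.isoModSerre.isLocal X → L.isoModSerre.isLocal Y →
      Function.Surjective ((restriction S).map : (X ⟶ Y) → _)) :
    IsConditionedEpi.{w, a} L S := by
  intro A _ _ _ F F' _ _ hF hFF'
  have hobj (g : G) : F.obj g = F'.obj g := by
    obtain ⟨u, rfl⟩ := hS g
    exact Functor.congr_obj hFF' u
  let e (g : G) : F.obj g ≅ F'.obj g := eqToIso (hobj g)
  have he {u u' : U} (f : u ⟶ u') :
      F.map (S.map f) = (e _).hom ≫ F'.map (S.map f) ≫ (e _).inv := Functor.congr_hom hFF' f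
  refine CategoryTheory.Functor.ext hobj fun g g' m => ?_
  -- The action of `F'` on morphisms into `g'`, transported along the equalities of objects.
  let c (g : G) : (g ⟶ g') →+ (F.obj g ⟶ F.obj g') :=
    AddMonoidHom.mk' (fun m => (e g).hom ≫ F'.map m ≫ (e g').inv) (by simp [F'.map_add])
  -- Linearity over `U` holds since `F` and `F'` agree on the morphisms `S f`.
  let φ : (restriction S).obj (representable g') ⟶
      (restriction S).obj ((homRestriction F).obj (F.obj g')) := ObjectProperty.homMk
    { app u := AddCommGrpCat.ofHom (c (S.obj u.unop))
      naturality u u' f := by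
        ext (m : S.obj u.unop ⟶ g')
        change (e _).hom ≫ F'.map (S.map f.unop ≫ m) ≫ (e g').inv =
          F.map (S.map f.unop) ≫ (e _).hom ≫ F'.map m ≫ (e g').inv
        simp [he] }
  obtain ⟨ψ, hψ⟩ := h _ _ (hL g') (hF.isLocal (F.obj g')) φ
  have key (g : G) (m : g ⟶ g') : ψ.hom.app (op g) m = c g m := by
    obtain ⟨u, rfl⟩ := hS g
    exact ConcreteCategory.congr_hom (NatTrans.congr_app (congrArg (·.hom) hψ) (op u)) m
  -- The Yoneda argument: `ψ` is determined by its value at `𝟙 g'`, which is the identity of `F.obj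
  -- g'`.
  have h₁ : ψ.hom.app (op g) (m ≫ 𝟙 g') = F.map m ≫ ψ.hom.app (op g') (𝟙 g') :=
    ConcreteCategory.congr_hom (ψ.hom.naturality m.op) (𝟙 g')
  rw [Category.comp_id, key, key] at h₁
  have h₂ : c g' (𝟙 g') = 𝟙 (F.obj g') := by simp [c]
  rw [h₂] at h₁
  exact ((Category.comp_id _).symm.trans h₁.symm)

end Restriction

/-! ### Raising the universe of objects of an abelian category. -/

section ULift

attribute [local instance] uliftCategory

variable (C : Type u) [Category.{v} C]

/-- The objects of `Abᵒᵖ` lie in universe `w + 1`. The lift makes it a test category for conditioned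
epimorphisms at level `max a (w + 1)`. -/
instance uliftPreadditive [Preadditive C] : Preadditive (ULift.{u'} C) where
  homGroup X Y := inferInstanceAs (AddCommGroup (X.down ⟶ Y.down))
  add_comp _ _ _ _ _ _ := Preadditive.add_comp (C := C) _ _ _ _ _ _
  comp_add _ _ _ _ _ _ := Preadditive.comp_add (C := C) _ _ _ _ _ _

instance [Preadditive C] : (ULift.upFunctor : C ⥤ ULift.{u'} C).Additive where

instance : (ULift.downFunctor : ULift.{u'} C ⥤ C).IsEquivalence :=
  ULift.equivalence.isEquivalence_inverse

noncomputable instance uliftAbelian [Abelian C] : Abelian (ULift.{u'} C) :=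
  have : HasFiniteProducts (ULift.{u'} C) := ⟨fun _ =>
    Adjunction.hasLimitsOfShape_of_equivalence ULift.downFunctor⟩
  abelianOfEquivalence ULift.downFunctor

instance [HasColimitsOfSize.{w, w} C] : HasColimitsOfSize.{w, w} (ULift.{u'} C) :=
  Adjunction.has_colimits_of_equivalence ULift.downFunctor

end ULift

/-! ### Modules as functors to `Abᵒᵖ`, and the conjugation argument. -/

section Dual

attribute [local instance] uliftCategory

variable {G : Type w} [SmallCategory G] [Preadditive G]

/-- A functor `Gᵒᵖ ⥤ Ab`, viewed as a covariant functor on `G` with values in `Abᵒᵖ`. -/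
abbrev dualFunctor (W : Gᵒᵖ ⥤ AddCommGrpCat.{w}) : G ⥤ ULift.{a} AddCommGrpCat.{w}ᵒᵖ :=
  W.rightOp ⋙ ULift.upFunctor

variable (W : ModCat G) (A : ULift.{a} AddCommGrpCat.{w}ᵒᵖ)

/-- An element of `(W g)^B`, viewed as a homomorphism `B ⟶ W g`. -/
def dualHom {g : Gᵒᵖ} (t : ((homRestriction (dualFunctor.{w, a} W.obj)).obj A).obj.obj g) :
    A.down.unop ⟶ W.obj.obj g := Quiver.Hom.unop t

/-- The homomorphism `Hom(B, W -) ⟶ W` given by evaluation at `b ∈ B`. -/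
def dualEval (b : A.down.unop) : (homRestriction (dualFunctor.{w, a} W.obj)).obj A ⟶ W :=
  ObjectProperty.homMk
    { app _ := AddCommGrpCat.ofHom
        (AddMonoidHom.mk' (fun t => dualHom W A t b) (fun _ _ => rfl))
      naturality _ _ _ := rfl }

variable {W A}

lemma hom_ext_dualEval {M : ModCat G} {f f' : M ⟶ (homRestriction (dualFunctor.{w, a} W.obj)).obj A}
    (h : ∀ b, f ≫ dualEval W A b = f' ≫ dualEval W A b) : f = f' := by
  ext : 1
  ext g m
  refine Quiver.Hom.unop_inj ?_
  refine ConcreteCategory.hom_ext _ _ fun b => ?_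
  exact ConcreteCategory.congr_hom (NatTrans.congr_app (congrArg (·.hom) (h b)) g) m

/-- Together with `hom_ext_dualEval` this identifies maps `M ⟶ Hom(B, W -)` with additive families
of maps `M ⟶ W` indexed by `B`. -/
lemma exists_comp_dualEval_eq {M : ModCat G} (t : A.down.unop → (M ⟶ W))
    (ht : ∀ b b', t (b + b') = t b + t b') :
    ∃ f : M ⟶ (homRestriction (dualFunctor.{w, a} W.obj)).obj A,
      ∀ b, f ≫ dualEval W A b = t b := by
  let c (g : Gᵒᵖ) (m : M.obj.obj g) : A.down.unop ⟶ W.obj.obj g :=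
    AddCommGrpCat.ofHom (AddMonoidHom.mk' (fun b => (t b).hom.app g m) (fun b b' => by
      rw [ht]
      rfl))
  let d (g : Gᵒᵖ) : M.obj.obj g →+
      ((homRestriction (dualFunctor.{w, a} W.obj)).obj A).obj.obj g :=
    AddMonoidHom.mk' (fun m => (c g m).op) (fun m m' => by
      refine Quiver.Hom.unop_inj ?_
      refine ConcreteCategory.hom_ext _ _ fun b => ?_
      exact map_add ((t b).hom.app g).hom m m')
  refine ⟨ObjectProperty.homMk
    { app g := AddCommGrpCat.ofHom (d g)
      naturality g g' f := by
        ext m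
        refine Quiver.Hom.unop_inj ?_
        refine ConcreteCategory.hom_ext _ _ fun b => ?_
        exact ConcreteCategory.congr_hom ((t b).hom.naturality f) m }, fun b => ?_⟩
  ext : 1
  ext g m
  rfl

lemma isLocal_homRestriction_dualFunctor {P : MorphismProperty (ModCat G)} (hW : P.isLocal W) :
    P.isLocal ((homRestriction (dualFunctor.{w, a} W.obj)).obj A) := by
  intro M N s hs
  refine ⟨fun f f' h => hom_ext_dualEval fun b => (hW s hs).1 ?_, fun f => ?_⟩
  · exact (Category.assoc _ _ _).symm.trans ((congrArg (· ≫ dualEval W A b) h).trans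
      (Category.assoc _ _ _))
  · choose t ht using fun b => (hW s hs).2 (f ≫ dualEval W A b)
    -- The extensions `t b` are chosen separately for each `b`. Uniqueness of extensions to the
    -- local module `W` makes them additive in `b`.
    obtain ⟨f', hf'⟩ := exists_comp_dualEval_eq t (fun b b' => (hW s hs).1 (by
      change s ≫ t (b + b') = s ≫ (t b + t b')
      have h (b) : s ≫ t b = f ≫ dualEval W A b := ht b
      rw [Preadditive.comp_add, h, h, h, ← Preadditive.comp_add]
      congr 1
      ext : 1
      ext g x
      exact map_add (dualHom W A x).hom b b'))
    refine ⟨f', hom_ext_dualEval fun b => ?_⟩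
    exact (Category.assoc _ _ _).trans ((congrArg (s ≫ ·) (hf' b)).trans (ht b))

/-- The functor obtained from `W` by transport along the automorphisms `1 + n g`, where
`n g` has square zero. -/
def conjFunctor (W : Gᵒᵖ ⥤ AddCommGrpCat.{w}) (n : ∀ g, W.obj g ⟶ W.obj g)
    (hn : ∀ g, n g ≫ n g = 0) : Gᵒᵖ ⥤ AddCommGrpCat.{w} where
  obj := W.obj
  map {g g'} f := (𝟙 _ - n g) ≫ W.map f ≫ (𝟙 _ + n g')
  map_id g := by simp [hn, Preadditive.sub_comp, Preadditive.comp_add]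
  map_comp {g g' g''} f f' := by
    have h : (𝟙 _ + n g') ≫ (𝟙 _ - n g') = 𝟙 _ := by
      simp [hn, Preadditive.add_comp, Preadditive.comp_sub]
    simp only [Category.assoc, reassoc_of% h, Functor.map_comp]

instance (W : Gᵒᵖ ⥤ AddCommGrpCat.{w}) [W.Additive] (n : ∀ g, W.obj g ⟶ W.obj g)
    (hn : ∀ g, n g ≫ n g = 0) : (conjFunctor W n hn).Additive where
  map_add {g g' f f'} := by
    change (𝟙 _ - n g) ≫ W.map (f + f') ≫ (𝟙 _ + n g') = (𝟙 _ - n g) ≫ W.map f ≫ (𝟙 _ + n g') +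
      (𝟙 _ - n g) ≫ W.map f' ≫ (𝟙 _ + n g')
    rw [W.map_add, Preadditive.add_comp, Preadditive.comp_add]
    rfl

variable {U : Type w} [SmallCategory U] [Preadditive U] {S : U ⥤ G}
  {L : ObjectProperty (ModCat G)} [IsLocalizing L]

/-- Conjugation by `1 + n`, with inverse `1 - n`, fixes `W.obj.map f` exactly when `n` commutes with
it. By `hS` the conjugated functor agrees with `W` on `U`, hence on all of `G`. -/
lemma IsConditionedEpi.natural (h : IsConditionedEpi.{w, max a (w + 1)} L S)
    (hW : L.isoModSerre.isLocal W) (n : ∀ g, W.obj.obj g ⟶ W.obj.obj g)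
    (hn : ∀ g, n g ≫ n g = 0)
    (hS : ∀ (u u' : U) (f : u ⟶ u'),
      W.obj.map (S.map f).op ≫ n (op (S.obj u)) = n (op (S.obj u')) ≫ W.obj.map (S.map f).op)
    {g g' : Gᵒᵖ} (f : g ⟶ g') : W.obj.map f ≫ n g' = n g ≫ W.obj.map f := by
  have hc {g g' : Gᵒᵖ} (f : g ⟶ g') : (conjFunctor W.obj n hn).map f = W.obj.map f ↔
      W.obj.map f ≫ n g' = n g ≫ W.obj.map f := by
    have h₁ : (𝟙 _ + n g) ≫ (𝟙 _ - n g) = 𝟙 _ := by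
      simp [hn, Preadditive.add_comp, Preadditive.comp_sub]
    have h₂ : (𝟙 _ - n g) ≫ (𝟙 _ + n g) = 𝟙 _ := by
      simp [hn, Preadditive.sub_comp, Preadditive.comp_add]
    have : IsIso (𝟙 _ + n g) := ⟨_, h₁, h₂⟩
    change (𝟙 _ - n g) ≫ W.obj.map f ≫ (𝟙 _ + n g') = W.obj.map f ↔ _
    rw [← cancel_epi (𝟙 (W.obj.obj g) + n g), reassoc_of% h₁, Preadditive.comp_add,
      Preadditive.add_comp, Category.comp_id, Category.id_comp, add_right_inj]
  refine (hc f).1 ?_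
  have hF : IsGeneralizedClosed L (dualFunctor.{w, a} W.obj) :=
    isGeneralizedClosed_of_isLocal fun A => isLocal_homRestriction_dualFunctor hW
  have h := h _ _ (dualFunctor.{w, a} (conjFunctor W.obj n hn)) hF
    (Functor.hext (fun _ => rfl) fun u u' f =>
      heq_of_eq (congrArg Quiver.Hom.op ((hc _).2 (hS u u' f))).symm)
  exact (congrArg Quiver.Hom.unop (eq_of_heq (Functor.hcongr_hom h f.unop))).symm

lemma IsConditionedEpi.surjective_map [S.Additive] (h : IsConditionedEpi.{w, max a (w + 1)} L S)
    (hS : Function.Bijective S.obj) {X Y : ModCat G} (hX : L.isoModSerre.isLocal X)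
    (hY : L.isoModSerre.isLocal Y) :
    Function.Surjective ((restriction S).map : (X ⟶ Y) → _) := by
  intro φ
  -- Bijectivity on objects reindexes the components of `φ` by the objects of `G`; injectivity makes
  -- this well defined.
  obtain ⟨θ, hθ⟩ : ∃ θ : ∀ g : G, X.obj.obj (op g) ⟶ Y.obj.obj (op g),
      ∀ u, θ (S.obj u) = φ.hom.app (op u) :=
    ⟨Equiv.piCongrLeft (fun g => X.obj.obj (op g) ⟶ Y.obj.obj (op g)) (Equiv.ofBijective _ hS)
      fun u => φ.hom.app (op u), fun u => Equiv.piCongrLeft_apply_apply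
        (fun g => X.obj.obj (op g) ⟶ Y.obj.obj (op g)) (Equiv.ofBijective _ hS) _ u⟩
  have hW : L.isoModSerre.isLocal (X ⊞ Y) :=
    ObjectProperty.prop_of_isLimit _ (BinaryBiproduct.isLimit X Y) (by rintro ⟨_ | _⟩ <;> assumption)
  let p : X ⊞ Y ⟶ X := biprod.fst
  let q : X ⊞ Y ⟶ Y := biprod.snd
  let i : X ⟶ X ⊞ Y := biprod.inl
  let j : Y ⟶ X ⊞ Y := biprod.inr
  have happ {M N : ModCat G} {f f' : M ⟶ N} (h : f = f') (g : Gᵒᵖ) : f.hom.app g = f'.hom.app g :=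
    h ▸ rfl
  have hjp (g) : j.hom.app g ≫ p.hom.app g = 0 := happ biprod.inr_fst g
  have hip (g) : i.hom.app g ≫ p.hom.app g = 𝟙 _ := happ biprod.inl_fst g
  have hjq (g) : j.hom.app g ≫ q.hom.app g = 𝟙 _ := happ biprod.inr_snd g
  have key {g g' : Gᵒᵖ} (f : g ⟶ g') :=
    -- The endomorphism `(x, y) ↦ (0, θ x)`, of square zero because `j` followed by `p` vanishes.
    h.natural hW (fun g => p.hom.app g ≫ θ g.unop ≫ j.hom.app g)
      (fun g => by simp [reassoc_of% hjp g]) (fun u u' f => by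
        have hφ : X.obj.map (S.map f).op ≫ θ (S.obj u) =
            θ (S.obj u') ≫ Y.obj.map (S.map f).op := by
          rw [hθ, hθ]
          exact φ.hom.naturality f.op
        rw [NatTrans.naturality_assoc, reassoc_of% hφ, Category.assoc, Category.assoc,
          NatTrans.naturality]) f
  refine ⟨ObjectProperty.homMk { app g := θ g.unop, naturality g g' f := ?_ }, ?_⟩
  · have h₁ := i.hom.app g ≫= key f =≫ q.hom.app g'
    simp only [Category.assoc, ← NatTrans.naturality, hjq, reassoc_of% hip, Category.comp_id,
      NatTrans.naturality_assoc] at h₁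
    simpa [hjq, reassoc_of% hip, ← NatTrans.naturality_assoc] using h₁
  · ext : 1
    ext u : 2
    exact hθ u.unop

end Dual

end SeveralObjects

open SeveralObjects
theorem theorem1p7 {U G : Type w} [SmallCategory U] [Preadditive U] [SmallCategory G]
    [Preadditive G] (S : U ⥤ G) [S.Additive] (hS : Function.Bijective S.obj)
    (L : ObjectProperty (ModCat G)) [IsLocalizing L]
    (hL : ∀ g : G, IsClosedModule L (representable g)) :
    List.TFAE
      [(sectionFunctor L ⋙ restriction S).Full,
       (sectionFunctor L ⋙ restriction S).Full ∧ (sectionFunctor L ⋙ restriction S).Faithful,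
       IsConditionedEpi.{w, max a (w + 1)} L S] := by
  have := restriction_faithful S hS.2
  tfae_have 1 → 2 := fun h => ⟨h, inferInstance⟩
  tfae_have 2 → 3 := fun h => isConditionedEpi_of_surjective_map hS.2 (fun g => (hL g).isLocal)
    (full_section_restriction_iff.1 h.1)
  tfae_have 3 → 1 := fun h =>
    full_section_restriction_iff.2 fun _ _ hX hY => h.surjective_map hS hX hY
  tfae_finish
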